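/- All graphs are finite and simple. For a real symmetric matrix $A$ let $\lambda_1(A)\le\lambda_2(A)\le\cdots$ be its eigenvalues, with multiplicity, and let $a(G)=\lambda_2(L(G))$ be the algebraic connectivity of a graph $G=(V,E)$ with Laplacian $L(G)$. Let $X=(\mathbb{R}^d,\|\cdot\|_X)$ be a normed space with dual norm $\|\cdot\|_X^*$. A support functional at a unit vector $x$ is a linear functional $\varphi$ with $\varphi(x)=1=\|\varphi\|_X^*$, and the norm is smooth at $x$ if there is exactly one. A framework $(G,p)$ in $X$ is given by $p=(p_v)_{v\in V}\in(\mathbb{R}^d)^V$ such that, for each edge $vw$, $p_v\neq p_w$ and the norm is smooth at $(p_v-p_w)/\|p_v-p_w\|_X$; let $\varphi_{v,w}$ be the support functional at this point. The rigidity matrix $R(G,p)$ is the $|E|\times d|V|$ matrix whose row indexed by an edge $e=vw$ has, for each $i\in\{1,\dots,d\}$, the entries $\varphi_{v,w}(b_i)$ in column $(v,i)$ and $\varphi_{w,v}(b_i)$ in column $(w,i)$, and zeros elsewhere, where $b_1,\dots,b_d$ is the standard basis; put $L(G,p)=R(G,p)^\top R(G,p)$. A rigid motion of $X$ is a family of continuous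 paths $\alpha_x:(-1,1)\to\mathbb{R}^d$, $x\in\mathbb{R}^d$, differentiable at $0$, with $\alpha_x(0)=x$ and $\|\alpha_x(t)-\alpha_y(t)\|_X=\|x-y\|_X$ for all $x,y\in\mathbb{R}^d$ and $t\in(-1,1)$; let $k(X)$ be the dimension of the real linear space of all maps $x\mapsto\alpha_x'(0)$ arising in this way. For a graph $G$ with at least $d+1$ vertices, the algebraic connectivity of $G$ in $X$ is $$a(G,X)=\sup\{\lambda_{k(X)+1}(L(G,p)) : (G,p)\text{ is a framework in }X\}.$$ Corollary. Let $1\le p\le\infty$, let $d\ge 2$, and let $G$ be a graph with at least $d+1$ vertices. If $p\ne 2$, then the set whose supremum defines $a(G,\ell_p^d)$ is non-empty and bounded above, and $$a(G,\ell_p^d)\le\begin{cases}\dfrac{1}{d^{\,2-2/p}}\,a(G) & \text{if } 1\le p<2,\\[2mm] \dfrac1d\,a(G) & \text{if } 2<p\le\infty.\end{cases}$$ -/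

import Mathlib

open scoped ENNReal

noncomputable section

namespace NormedRigidity

section Eigenvalues

variable {ι : Type*} [Fintype ι] [DecidableEq ι]

/-- `eig hA j` is the `j`-th smallest eigenvalue (`1 ≤ j ≤ n`, repeated according to multiplicity)
of the real symmetric `n × n` matrix `A`: Mathlib's `eigenvalues₀` lists the eigenvalues in
decreasing order with indices `0, …, n - 1`. Outside the range `1 ≤ j ≤ n` the value is `0`. -/
def eig {A : Matrix ι ι ℝ} (hA : A.IsHermitian) (j : ℕ) : ℝ :=
  if h : 1 ≤ j ∧ j ≤ Fintype.card ι then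
    hA.eigenvalues₀ ⟨Fintype.card ι - j, by omega⟩
  else 0

end Eigenvalues

section Graphs

variable {V : Type*} [Fintype V] [DecidableEq V]

/-- The algebraic connectivity (Fiedler number) `a(G)`: the second smallest eigenvalue of the
graph Laplacian. -/
def algConn (G : SimpleGraph V) [DecidableRel G.Adj] : ℝ :=
  eig (G.posSemidef_lapMatrix ℝ).isHermitian 2

end Graphs

section NormedSpaces

variable {E : Type*} [NormedAddCommGroup E] [NormedSpace ℝ E]

/-- `φ` is a support functional at `x`: `φ x = 1` and `φ` has dual norm `1`. -/
def IsSupportFunctional (x : E) (φ : E →L[ℝ] ℝ) : Prop :=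
  φ x = 1 ∧ ‖φ‖ = 1

/-- The norm is smooth at the unit vector `x`: there is exactly one support functional at `x`. -/
def IsSmoothPoint (x : E) : Prop :=
  ‖x‖ = 1 ∧ ∃! φ : E →L[ℝ] ℝ, IsSupportFunctional x φ

open Classical in
/-- The unique support functional at a smooth point `x` (and `0` if `x` is not a smooth point). -/
def supportFunctional (x : E) : E →L[ℝ] ℝ :=
  if h : IsSmoothPoint x then h.2.choose else 0

/-- A rigid motion of `E`: a family of continuous paths `α x : (-1, 1) → E` starting (at time `0`)
at `x`, differentiable at `0`, and preserving all distances at all times. Values of `α x` outside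
`(-1, 1)` are irrelevant. -/
structure IsRigidMotion (α : E → ℝ → E) : Prop where
  apply_zero : ∀ x, α x 0 = x
  continuousOn : ∀ x, ContinuousOn (α x) (Set.Ioo (-1) 1)
  differentiableAt : ∀ x, DifferentiableAt ℝ (α x) 0
  dist_eq : ∀ t ∈ Set.Ioo (-1 : ℝ) 1, ∀ x y, ‖α x t - α y t‖ = ‖x - y‖

/-- `η` is an infinitesimal rigid motion: the initial velocity field of a rigid motion. -/
def IsInfinitesimalRigidMotion (η : E → E) : Prop :=
  ∃ α : E → ℝ → E, IsRigidMotion α ∧ ∀ x, η x = deriv (α x) 0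

variable (E) in
/-- The linear space `T(X)` of infinitesimal rigid motions, under pointwise operations. (In a
finite-dimensional space the infinitesimal rigid motions are closed under these operations, so
that taking the span adds nothing.) -/
def infinitesimalRigidMotions : Submodule ℝ (E → E) :=
  Submodule.span ℝ {η | IsInfinitesimalRigidMotion η}

variable (E) in
/-- `k(X)`, the dimension of the space of infinitesimal rigid motions. -/
def rigidMotionDim : ℕ :=
  Module.finrank ℝ (infinitesimalRigidMotions E)

/-- The normalised difference `(x - y) / ‖x - y‖`. -/
def direction (x y : E) : E :=
  ‖x - y‖⁻¹ • (x - y)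

end NormedSpaces

section Frameworks

variable {V : Type*} [Fintype V] [DecidableEq V]
variable {E : Type*} [NormedAddCommGroup E] [NormedSpace ℝ E]

/-- `(G, p)` is a framework in `E`: for each edge `vw` the points `p v`, `p w` are distinct and the
norm is smooth at the normalised vector from `p w` to `p v`. -/
def IsFramework (G : SimpleGraph V) (p : V → E) : Prop :=
  ∀ v w, G.Adj v w → p v ≠ p w ∧ IsSmoothPoint (direction (p v) (p w))

variable (G : SimpleGraph V) [DecidableRel G.Adj]

/-- The rigidity matrix `R(G, p)`, where `b` is the standard basis. The row of an edge `e = vw` has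
the entry `φ_{v,w} (b i)` in column `(v, i)` (hence `φ_{w,v} (b i) = -φ_{v,w} (b i)` in column
`(w, i)`), and zeros elsewhere. -/
def rigidityMatrix {d : ℕ} (b : Module.Basis (Fin d) ℝ E) (p : V → E) :
    Matrix G.edgeSet (V × Fin d) ℝ :=
  fun e vi =>
    if h : vi.1 ∈ (e : Sym2 V) then
      supportFunctional (direction (p vi.1) (p (Sym2.Mem.other h))) (b vi.2)
    else 0

/-- The framework Laplacian `L(G, p) = R(G, p)ᵀ R(G, p)`. -/
def frameworkLaplacian {d : ℕ} (b : Module.Basis (Fin d) ℝ E) (p : V → E) :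
    Matrix (V × Fin d) (V × Fin d) ℝ :=
  (rigidityMatrix G b p).transpose * rigidityMatrix G b p

theorem isHermitian_frameworkLaplacian {d : ℕ} (b : Module.Basis (Fin d) ℝ E) (p : V → E) :
    (frameworkLaplacian G b p).IsHermitian := by
  have h := Matrix.isHermitian_conjTranspose_mul_self (rigidityMatrix G b p)
  rwa [Matrix.conjTranspose_eq_transpose_of_trivial] at h

/-- The rigidity eigenvalue `λ_{k(X)+1}(L(G, p))`. -/
def rigidityEigenvalue {d : ℕ} (b : Module.Basis (Fin d) ℝ E) (p : V → E) : ℝ :=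
  eig (isHermitian_frameworkLaplacian G b p) (rigidMotionDim E + 1)

/-- The set of rigidity eigenvalues of all frameworks `(G, p)` in the normed space `E` with
standard basis `b`. -/
def rigidityEigenvalues {d : ℕ} (b : Module.Basis (Fin d) ℝ E) : Set ℝ :=
  {r | ∃ p : V → E, IsFramework G p ∧ r = rigidityEigenvalue G b p}

/-- The algebraic connectivity `a(G, X)` of `G` in the normed space `X`, given as the space `E` with
standard basis `b`: the supremum of the rigidity eigenvalues of all frameworks `(G, p)`. -/
def algConnIn {d : ℕ} (b : Module.Basis (Fin d) ℝ E) : ℝ :=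
  sSup (rigidityEigenvalues G b)

/-- The space `ℓ_q^d`. -/
abbrev Lq (q : ℝ≥0∞) (d : ℕ) : Type :=
  PiLp q (fun _ : Fin d => ℝ)

/-- The standard basis of `ℓ_q^d`. -/
abbrev stdBasis (q : ℝ≥0∞) (d : ℕ) : Module.Basis (Fin d) ℝ (Lq q d) :=
  PiLp.basisFun q ℝ (Fin d)

end Frameworks

end NormedRigidity

end

/-! The eigenvalue is bounded by testing the Rayleigh quotient on a space of dimension `d + 1`. Take
`y` orthogonal to the constants with Laplacian Rayleigh quotient at most `a(G)`, and consider the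
velocity fields `v ↦ c + s y_v b_i` with `i` fixed. Translations contribute nothing to `R(G, p)`, so
the edge `vw` contributes `s² φ(b_i)² (y_v - y_w)²`, where `φ` is its support functional. If every
functional of dual norm at most 1 satisfies `∑ i, φ(b_i)² ≤ C`, summing over `i` and averaging gives
some `i` with quotient at most `C a(G) / d`. This is `rigidityEigenvalue_le`; it concerns
`λ_{k(X)+1}` as soon as `k(X) ≤ d`.

For `ℓ_q^d` two inputs remain. When `q ≠ 2`, infinitesimal rigid motions are constant fields
(`rigidMotionDim_Lq_le`), because a functional norming `x - y` annihilates `η x - η y`. Duality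
reduces the constant `C` to comparing the `ℓ_q` and Euclidean norms: `C = 1` for `q > 2`, and `C = d
^ (2/q - 1)` for `q < 2`. A framework on a line in a smooth direction makes the set of eigenvalues
non-empty. -/

namespace NormedRigidity

/-! ### Variational bounds for eigenvalues -/

section EigenvalueBounds

open Matrix

variable {ι : Type*} [Fintype ι] [DecidableEq ι] {A : Matrix ι ι ℝ}

theorem dotProduct_self_eq_sum_eigenvectorBasis (hA : A.IsHermitian) (x : ι → ℝ) :
    x ⬝ᵥ x = ∑ i, (⇑(hA.eigenvectorBasis i) ⬝ᵥ x) ^ 2 := by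
  have h := hA.eigenvectorBasis.sum_inner_mul_inner (WithLp.toLp 2 x) (WithLp.toLp 2 x)
  simp only [EuclideanSpace.inner_eq_star_dotProduct, star_trivial] at h
  rw [← h]
  refine Finset.sum_congr rfl fun i _ => ?_
  rw [sq, dotProduct_comm x]

theorem dotProduct_mulVec_eq_sum_eigenvalues (hA : A.IsHermitian) (x : ι → ℝ) :
    x ⬝ᵥ A *ᵥ x = ∑ i, hA.eigenvalues i * (⇑(hA.eigenvectorBasis i) ⬝ᵥ x) ^ 2 := by
  have h := hA.eigenvectorBasis.sum_inner_mul_inner (WithLp.toLp 2 x) (WithLp.toLp 2 (A *ᵥ x))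
  simp only [EuclideanSpace.inner_eq_star_dotProduct, star_trivial] at h
  rw [dotProduct_comm, ← h]
  refine Finset.sum_congr rfl fun i _ => ?_
  have hs : Aᵀ = A := by
    have := hA.eq
    rwa [conjTranspose_eq_transpose_of_trivial] at this
  rw [dotProduct_comm (A *ᵥ x), dotProduct_mulVec, ← mulVec_transpose, hs,
    hA.mulVec_eigenvectorBasis, smul_dotProduct, smul_eq_mul]
  ring

/-- Spectral expansion of the Rayleigh quotient along the decreasing list of eigenvalues. -/
theorem exists_reindexed_expansion (hA : A.IsHermitian) :
    ∃ v : Fin (Fintype.card ι) → (ι → ℝ),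
      (∀ x : ι → ℝ, x ⬝ᵥ x = ∑ k, (v k ⬝ᵥ x) ^ 2) ∧
      ∀ x : ι → ℝ, x ⬝ᵥ A *ᵥ x = ∑ k, hA.eigenvalues₀ k * (v k ⬝ᵥ x) ^ 2 := by
  set e : Fin (Fintype.card ι) ≃ ι := Fintype.equivOfCardEq (Fintype.card_fin _) with he
  refine ⟨fun k => ⇑(hA.eigenvectorBasis (e k)), fun x => ?_, fun x => ?_⟩
  · rw [dotProduct_self_eq_sum_eigenvectorBasis hA, ← e.sum_comp]
  · rw [dotProduct_mulVec_eq_sum_eigenvalues hA, ← e.sum_comp]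
    simp only [Matrix.IsHermitian.eigenvalues, ← he, Equiv.symm_apply_apply]

/-- One half of the Courant–Fischer theorem: the `m`-th smallest eigenvalue is at most any upper
bound of the Rayleigh quotient on an `m`-dimensional space. -/
theorem eig_le_of_forall_le (hA : A.IsHermitian) {F : Type*} [AddCommGroup F] [Module ℝ F]
    [FiniteDimensional ℝ F] {m : ℕ} (hm : 1 ≤ m) (hmF : m ≤ Module.finrank ℝ F)
    (f : F →ₗ[ℝ] ι → ℝ) (hf : Function.Injective f) {c : ℝ}
    (h : ∀ y, f y ⬝ᵥ A *ᵥ f y ≤ c * (f y ⬝ᵥ f y)) : eig hA m ≤ c := by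
  -- Injectivity puts `m` in range, so `eig` does not take its default value 0.
  have hcard : m ≤ Fintype.card ι := by
    simpa using hmF.trans (LinearMap.finrank_le_finrank_of_injective hf)
  rw [eig, dif_pos ⟨hm, hcard⟩]
  obtain ⟨v, hv1, hv2⟩ := exists_reindexed_expansion hA
  set j : Fin (Fintype.card ι) := ⟨Fintype.card ι - m, by omega⟩ with hj
  -- In decreasing order the `m - 1` eigenvalues below the `m`-th smallest have index `> j`. Killing
  -- those components imposes `m - 1` conditions on a space of dimension at least `m`.
  let g : F →ₗ[ℝ] (Finset.Ioi j → ℝ) :=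
    LinearMap.pi fun k => (dotProductBilin ℝ ℝ (v k)).comp f
  have hg : LinearMap.ker g ≠ ⊥ := by
    apply LinearMap.ker_ne_bot_of_finrank_lt
    rw [Module.finrank_fintype_fun_eq_card, Fintype.card_coe, Fin.card_Ioi]
    simp only [hj]
    omega
  obtain ⟨y, hy, hy0⟩ := (Submodule.ne_bot_iff _).1 hg
  have hk : ∀ k, j < k → v k ⬝ᵥ f y = 0 := fun k hk =>
    congrFun (LinearMap.mem_ker.1 hy) ⟨k, Finset.mem_Ioi.2 hk⟩
  have hfy : f y ≠ 0 := fun h0 => hy0 (hf (by simpa using h0))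
  have hpos : 0 < f y ⬝ᵥ f y := by
    refine lt_of_le_of_ne ?_ (fun h0 => hfy (dotProduct_self_eq_zero.1 h0.symm))
    exact Finset.sum_nonneg fun i _ => mul_self_nonneg _
  refine le_of_mul_le_mul_right (le_trans ?_ (h y)) hpos
  rw [hv1, hv2, Finset.mul_sum]
  refine Finset.sum_le_sum fun k _ => ?_
  rcases lt_or_ge j k with hjk | hjk
  · simp [hk k hjk]
  · exact mul_le_mul_of_nonneg_right (hA.eigenvalues₀_antitone hjk) (sq_nonneg _)

/-- Fewer than `m` linear conditions leave a nonzero vector whose Rayleigh quotient is at most the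
`m`-th smallest eigenvalue. -/
theorem exists_ne_zero_dotProduct_mulVec_le_eig (hA : A.IsHermitian) {F : Type*} [AddCommGroup F]
    [Module ℝ F] [FiniteDimensional ℝ F] {m : ℕ} (hm : Module.finrank ℝ F < m)
    (hcard : m ≤ Fintype.card ι) (f : (ι → ℝ) →ₗ[ℝ] F) :
    ∃ x : ι → ℝ, x ≠ 0 ∧ f x = 0 ∧ x ⬝ᵥ A *ᵥ x ≤ eig hA m * (x ⬝ᵥ x) := by
  rw [eig, dif_pos ⟨by omega, hcard⟩]
  obtain ⟨v, hv1, hv2⟩ := exists_reindexed_expansion hA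
  set j : Fin (Fintype.card ι) := ⟨Fintype.card ι - m, by omega⟩ with hj
  -- Killing the components before index `j` costs `card ι - m` conditions. Together with `f` this
  -- makes fewer than `card ι`.
  let g : (ι → ℝ) →ₗ[ℝ] (Finset.Iio j → ℝ) × F :=
    (LinearMap.pi fun k : Finset.Iio j => dotProductBilin ℝ ℝ (v k)).prod f
  have hg : LinearMap.ker g ≠ ⊥ := by
    apply LinearMap.ker_ne_bot_of_finrank_lt
    rw [Module.finrank_prod, Module.finrank_fintype_fun_eq_card, Fintype.card_coe, Fin.card_Iio,
      Module.finrank_fintype_fun_eq_card]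
    simp only [hj]
    omega
  obtain ⟨x, hx, hx0⟩ := (Submodule.ne_bot_iff _).1 hg
  have hx' := LinearMap.mem_ker.1 hx
  have hk : ∀ k, k < j → v k ⬝ᵥ x = 0 := fun k hk =>
    congrFun (congrArg Prod.fst hx') ⟨k, Finset.mem_Iio.2 hk⟩
  refine ⟨x, hx0, congrArg Prod.snd hx', ?_⟩
  rw [hv1, hv2, Finset.mul_sum]
  refine Finset.sum_le_sum fun k _ => ?_
  rcases lt_or_ge k j with hjk | hjk
  · simp [hk k hjk]
  · exact mul_le_mul_of_nonneg_right (hA.eigenvalues₀_antitone hjk) (sq_nonneg _)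

end EigenvalueBounds

/-! ### The Laplacian quadratic form as a sum over edges -/

section EdgeSums

variable {V : Type*} [Fintype V] [DecidableEq V] (G : SimpleGraph V) [DecidableRel G.Adj]

/-- Each edge carries exactly two darts, and darts are the ordered adjacent pairs. -/
theorem two_mul_sum_edgeSet (F : Sym2 V → ℝ) :
    2 * ∑ e : G.edgeSet, F e = ∑ i, ∑ j, if G.Adj i j then F s(i, j) else 0 := by
  have h1 : ∑ D : G.Dart, F D.edge = ∑ i, ∑ j, if G.Adj i j then F s(i, j) else 0 := by
    rw [← Fintype.sum_prod_type' (f := fun i j => if G.Adj i j then F s(i, j) else 0),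
      ← Finset.sum_filter]
    refine Finset.sum_bij (fun D _ => D.toProd) ?_ ?_ ?_ ?_
    · intro D _
      simp [D.adj]
    · intro D _ D' _ h
      exact SimpleGraph.Dart.ext _ _ h
    · intro p hp
      exact ⟨⟨p, by simpa using hp⟩, Finset.mem_univ _, rfl⟩
    · intro D _
      rfl
  rw [← h1, ← Finset.sum_fiberwise_of_maps_to (s := Finset.univ) (t := Finset.univ)
    (g := fun D : G.Dart => (⟨D.edge, D.edge_mem⟩ : G.edgeSet)) (fun _ _ => Finset.mem_univ _),
    Finset.mul_sum]
  refine Finset.sum_congr rfl fun e _ => ?_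
  have h2 : ∀ D ∈ Finset.univ.filter
      (fun D : G.Dart => (⟨D.edge, D.edge_mem⟩ : G.edgeSet) = e), F D.edge = F e := by
    intro D hD
    rw [← (Finset.mem_filter.1 hD).2]
  rw [Finset.sum_congr rfl h2, Finset.sum_const, nsmul_eq_mul]
  have h3 := G.dart_edge_fiber_card e e.2
  simp only [Subtype.ext_iff]
  rw [h3]
  norm_num

/-- There is a nonzero vector orthogonal to the constants whose Rayleigh quotient for the graph
Laplacian is at most the algebraic connectivity. -/
theorem exists_sum_edgeSet_le_algConn (hV : 2 ≤ Fintype.card V) :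
    ∃ y : V → ℝ, y ≠ 0 ∧ ∑ v, y v = 0 ∧
      ∀ F : Sym2 V → ℝ, (∀ v w, F s(v, w) = (y v - y w) ^ 2) →
        ∑ e : G.edgeSet, F e ≤ algConn G * ∑ v, y v ^ 2 := by
  obtain ⟨y, hy0, hy1, hy⟩ := exists_ne_zero_dotProduct_mulVec_le_eig
    (G.posSemidef_lapMatrix ℝ).isHermitian (m := 2) (F := ℝ) (by simp) hV
    (Fintype.linearCombination ℝ (fun _ : V => (1 : ℝ)))
  refine ⟨y, hy0, by simpa [Fintype.linearCombination_apply] using hy1, fun F hF => ?_⟩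
  have h := G.lapMatrix_toLinearMap₂' ℝ y
  rw [Matrix.toLinearMap₂'_apply'] at h
  have h2 := two_mul_sum_edgeSet G F
  simp only [hF] at h2
  rw [h, ← h2] at hy
  have h3 : y ⬝ᵥ y = ∑ v, y v ^ 2 := by simp [dotProduct, sq]
  rw [h3] at hy
  unfold algConn
  linarith

end EdgeSums

/-! ### Support functionals and antipodal points -/

section SupportFunctionals

variable {E : Type*} [NormedAddCommGroup E] [NormedSpace ℝ E]

theorem supportFunctional_eq {x : E} (hx : IsSmoothPoint x) {φ : E →L[ℝ] ℝ}
    (hφ : IsSupportFunctional x φ) : supportFunctional x = φ := by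
  rw [supportFunctional, dif_pos hx]
  exact hx.2.unique hx.2.choose_spec.1 hφ

theorem isSupportFunctional_supportFunctional {x : E} (hx : IsSmoothPoint x) :
    IsSupportFunctional x (supportFunctional x) := by
  rw [supportFunctional, dif_pos hx]
  exact hx.2.choose_spec.1

theorem IsSupportFunctional.neg {x : E} {φ : E →L[ℝ] ℝ} (h : IsSupportFunctional x φ) :
    IsSupportFunctional (-x) (-φ) :=
  ⟨by simpa using h.1, by simpa using h.2⟩

theorem IsSmoothPoint.neg {x : E} (hx : IsSmoothPoint x) : IsSmoothPoint (-x) := by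
  obtain ⟨hn, φ, hφ, hu⟩ := hx
  refine ⟨by simpa using hn, -φ, hφ.neg, fun ψ hψ => ?_⟩
  have h := hψ.neg
  rw [neg_neg] at h
  rw [← hu _ h, neg_neg]

theorem supportFunctional_neg {x : E} (hx : IsSmoothPoint x) :
    supportFunctional (-x) = -supportFunctional x :=
  supportFunctional_eq hx.neg (isSupportFunctional_supportFunctional hx).neg

theorem direction_swap (x y : E) : direction y x = -direction x y := by
  rw [direction, direction, norm_sub_rev, ← smul_neg, neg_sub]

end SupportFunctionals

/-! ### The upper bound in a general normed space -/

section UpperBound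

open Matrix

variable {V : Type*} [Fintype V] [DecidableEq V]
variable {E : Type*} [NormedAddCommGroup E] [NormedSpace ℝ E]
variable (G : SimpleGraph V) [DecidableRel G.Adj] {d : ℕ} (b : Module.Basis (Fin d) ℝ E)

theorem rigidityMatrix_apply_left (p : V → E) {v w : V} (h : G.Adj v w) (i : Fin d) :
    rigidityMatrix G b p ⟨s(v, w), h⟩ (v, i) =
      supportFunctional (direction (p v) (p w)) (b i) := by
  have hv : v ∈ s(v, w) := Sym2.mem_mk_left v w
  have ho : Sym2.Mem.other hv = w := Sym2.congr_right.1 (Sym2.other_spec hv)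
  simp only [rigidityMatrix]
  rw [dif_pos hv, ho]

theorem rigidityMatrix_apply_right (p : V → E) {v w : V} (h : G.Adj v w) (i : Fin d) :
    rigidityMatrix G b p ⟨s(v, w), h⟩ (w, i) =
      supportFunctional (direction (p w) (p v)) (b i) := by
  have he : (⟨s(v, w), h⟩ : G.edgeSet) = ⟨s(w, v), h.symm⟩ := Subtype.ext Sym2.eq_swap
  rw [he]
  exact rigidityMatrix_apply_left G b p h.symm i

theorem rigidityMatrix_apply_of_ne (p : V → E) {v w : V} (h : G.Adj v w) {u : V} (huv : u ≠ v)
    (huw : u ≠ w) (i : Fin d) : rigidityMatrix G b p ⟨s(v, w), h⟩ (u, i) = 0 := by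
  simp only [rigidityMatrix]
  rw [dif_neg]
  simp [huv, huw]

/-- The rigidity matrix applied to a velocity field. -/
theorem rigidityMatrix_mulVec {p : V → E} (hp : IsFramework G p) {v w : V} (h : G.Adj v w)
    (x : V × Fin d → ℝ) :
    (rigidityMatrix G b p *ᵥ x) ⟨s(v, w), h⟩ =
      ∑ i, supportFunctional (direction (p v) (p w)) (b i) * (x (v, i) - x (w, i)) := by
  have hφ : supportFunctional (direction (p w) (p v)) =
      -supportFunctional (direction (p v) (p w)) := by
    rw [direction_swap, supportFunctional_neg (hp v w h).2]
  rw [mulVec, dotProduct, Fintype.sum_prod_type, ← Finset.sum_subset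
    (Finset.subset_univ ({v, w} : Finset V)), Finset.sum_pair h.ne, ← Finset.sum_add_distrib]
  · refine Finset.sum_congr rfl fun i _ => ?_
    rw [rigidityMatrix_apply_left, rigidityMatrix_apply_right, hφ]
    simp only [_root_.neg_apply]
    ring
  · intro u _ hu
    simp only [Finset.mem_insert, Finset.mem_singleton, not_or] at hu
    refine Finset.sum_eq_zero fun i _ => ?_
    rw [rigidityMatrix_apply_of_ne G b p h hu.1 hu.2, zero_mul]

/-- The velocity fields `v ↦ c + s y_v b_i`. -/
def testField (y : V → ℝ) (i : Fin d) : (Fin d → ℝ) × ℝ →ₗ[ℝ] V × Fin d → ℝ where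
  toFun z vj := z.1 vj.2 + z.2 * (y vj.1 * if vj.2 = i then 1 else 0)
  map_add' z z' := by
    ext vj
    simp only [Prod.fst_add, Prod.snd_add, Pi.add_apply]
    ring
  map_smul' r z := by
    ext vj
    simp only [Prod.smul_fst, Prod.smul_snd, Pi.smul_apply, smul_eq_mul, RingHom.id_apply]
    ring

/-- The cross term is a multiple of `∑ v, y v`, so it vanishes. -/
theorem testField_dotProduct_self {y : V → ℝ} (hy : ∑ v, y v = 0) (i : Fin d)
    (z : (Fin d → ℝ) × ℝ) :
    testField y i z ⬝ᵥ testField y i z =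
      Fintype.card V * ∑ j, z.1 j ^ 2 + z.2 ^ 2 * ∑ v, y v ^ 2 := by
  have h1 : ∀ v, ∑ j, testField y i z (v, j) * testField y i z (v, j) =
      ∑ j, z.1 j ^ 2 + 2 * z.2 * z.1 i * y v + z.2 ^ 2 * y v ^ 2 := by
    intro v
    have h2 : ∀ j, testField y i z (v, j) * testField y i z (v, j) =
        z.1 j ^ 2 + if j = i then 2 * z.2 * z.1 i * y v + z.2 ^ 2 * y v ^ 2 else 0 := by
      intro j
      simp only [testField, LinearMap.coe_mk, AddHom.coe_mk]
      split_ifs with hj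
      · rw [hj]; ring
      · ring
    simp only [h2, Finset.sum_add_distrib, Finset.sum_ite_eq', Finset.mem_univ, if_true]
    ring
  rw [dotProduct, Fintype.sum_prod_type]
  simp only [h1, Finset.sum_add_distrib, ← Finset.mul_sum, hy, Finset.sum_const, Finset.card_univ,
    nsmul_eq_mul]
  ring

/-- If the coordinate vector of every functional of dual norm at most `1` has squared Euclidean norm
at most `C`, and the space of infinitesimal rigid motions has dimension at most `d`, then every
rigidity eigenvalue is at most `C / d` times the algebraic connectivity. -/
theorem rigidityEigenvalue_le (hd : 1 ≤ d) (hV : d + 1 ≤ Fintype.card V)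
    (hk : rigidMotionDim E ≤ d) {C : ℝ}
    (hC : ∀ φ : E →L[ℝ] ℝ, ‖φ‖ ≤ 1 → ∑ i, φ (b i) ^ 2 ≤ C) {p : V → E} (hp : IsFramework G p) :
    rigidityEigenvalue G b p ≤ C / d * algConn G := by
  obtain ⟨y, hy0, hy1, hy⟩ := exists_sum_edgeSet_le_algConn G (by omega)
  have hC0 : 0 ≤ C := by simpa using hC 0 (by simp)
  have hd0 : (0 : ℝ) < d := by exact_mod_cast hd
  let F : Sym2 V → ℝ := Sym2.lift ⟨fun v w => (y v - y w) ^ 2, fun v w => by ring⟩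
  have hF : ∀ v w, F s(v, w) = (y v - y w) ^ 2 := fun v w => rfl
  have hyF := hy F hF
  have hF0 : 0 ≤ ∑ e : G.edgeSet, F e := by
    refine Finset.sum_nonneg fun e _ => ?_
    obtain ⟨e, he⟩ := e
    induction e with | _ v w => exact sq_nonneg _
  have hypos : 0 < ∑ v, y v ^ 2 := by
    obtain ⟨v, hv⟩ := Function.ne_iff.1 hy0
    exact Finset.sum_pos' (fun _ _ => sq_nonneg _) ⟨v, Finset.mem_univ _, by have : y v ≠ 0 := hv; positivity⟩
  have ha : 0 ≤ algConn G := nonneg_of_mul_nonneg_left (hF0.trans hyF) hypos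
  set R := rigidityMatrix G b p with hR
  -- The translation part `z.1` cancels in the difference along each edge.
  have hrow : ∀ i z, R *ᵥ testField y i z = z.2 • (R *ᵥ testField y i (0, 1)) := by
    intro i z
    ext ⟨e, he⟩
    induction e with | _ v w =>
    rw [Pi.smul_apply, rigidityMatrix_mulVec G b hp he, rigidityMatrix_mulVec G b hp he,
      Finset.smul_sum]
    refine Finset.sum_congr rfl fun j _ => ?_
    simp only [testField, LinearMap.coe_mk, AddHom.coe_mk, smul_eq_mul, Pi.zero_apply]
    ring
  have hrowF : ∀ e : G.edgeSet, ∑ i, (R *ᵥ testField y i (0, 1)) e ^ 2 ≤ C * F e := by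
    rintro ⟨e, he⟩
    induction e with | _ v w =>
    have hs := isSupportFunctional_supportFunctional (hp v w he).2
    have h1 : ∀ i, (R *ᵥ testField y i (0, 1)) ⟨s(v, w), he⟩ ^ 2 =
        supportFunctional (direction (p v) (p w)) (b i) ^ 2 * (y v - y w) ^ 2 := by
      intro i
      rw [rigidityMatrix_mulVec G b hp he, Finset.sum_eq_single i]
      · simp only [testField, LinearMap.coe_mk, AddHom.coe_mk, Pi.zero_apply, if_true]
        ring
      · intro j _ hj
        simp [testField, hj]
      · simp
    simp only [h1, hF, ← Finset.sum_mul]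
    exact mul_le_mul_of_nonneg_right (hC _ hs.2.le) (sq_nonneg _)
  -- The sum of these energies over all `d` directions is at most `C * (algConn G * ∑ v, y v ^ 2)`,
  -- so some direction does no worse than the average.
  obtain ⟨i, hi⟩ : ∃ i : Fin d, ∑ e, (R *ᵥ testField y i (0, 1)) e ^ 2 ≤
      C / d * (algConn G * ∑ v, y v ^ 2) := by
    have hne : (Finset.univ : Finset (Fin d)).Nonempty := ⟨⟨0, hd⟩, Finset.mem_univ _⟩
    obtain ⟨i, -, hi⟩ := Finset.exists_le_of_sum_le hne
      (f := fun i => ∑ e, (R *ᵥ testField y i (0, 1)) e ^ 2)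
      (g := fun _ => C / d * (algConn G * ∑ v, y v ^ 2)) (by
        rw [Finset.sum_comm, Finset.sum_const, Finset.card_univ, Fintype.card_fin, nsmul_eq_mul]
        calc _ ≤ ∑ e : G.edgeSet, C * F e := Finset.sum_le_sum fun e _ => hrowF e
          _ = C * ∑ e : G.edgeSet, F e := by rw [Finset.mul_sum]
          _ ≤ C * (algConn G * ∑ v, y v ^ 2) := mul_le_mul_of_nonneg_left hyF hC0
          _ = _ := by field_simp)
    exact ⟨i, hi⟩
  have hsq : ∀ x : V × Fin d → ℝ, x ⬝ᵥ frameworkLaplacian G b p *ᵥ x = ∑ e, (R *ᵥ x) e ^ 2 := by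
    intro x
    rw [frameworkLaplacian, ← mulVec_mulVec, dotProduct_mulVec, vecMul_transpose, dotProduct]
    exact Finset.sum_congr rfl fun e _ => (sq _).symm
  refine eig_le_of_forall_le _ (by omega) ?_ (testField y i) ?_ fun z => ?_
  · rw [Module.finrank_prod]
    simpa using hk
  · rw [← LinearMap.ker_eq_bot, LinearMap.ker_eq_bot']
    intro z hz
    have h := testField_dotProduct_self hy1 i z
    rw [hz, zero_dotProduct] at h
    have hc : (0 : ℝ) < Fintype.card V := by
      have : 0 < Fintype.card V := by omega
      exact_mod_cast this
    have h1 : 0 ≤ ∑ j, z.1 j ^ 2 := Finset.sum_nonneg fun _ _ => sq_nonneg _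
    have h2 : 0 ≤ z.2 ^ 2 * ∑ v, y v ^ 2 := by positivity
    have h3 : ∑ j, z.1 j ^ 2 = 0 := by
      have := mul_nonneg hc.le h1
      have h4 : (Fintype.card V : ℝ) * ∑ j, z.1 j ^ 2 = 0 := by linarith
      exact (mul_eq_zero.1 h4).resolve_left hc.ne'
    have h5 : z.2 ^ 2 * ∑ v, y v ^ 2 = 0 := by rw [h3] at h; linarith
    refine Prod.ext (funext fun j => ?_) ?_
    · have := (Finset.sum_eq_zero_iff_of_nonneg fun _ _ => sq_nonneg _).1 h3 j (Finset.mem_univ _)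
      exact pow_eq_zero_iff two_ne_zero |>.1 this
    · exact pow_eq_zero_iff two_ne_zero |>.1 ((mul_eq_zero.1 h5).resolve_right hypos.ne')
  · rw [hsq, hrow, testField_dotProduct_self hy1]
    simp only [Pi.smul_apply, smul_eq_mul, mul_pow, ← Finset.mul_sum]
    -- Translations only enlarge the right-hand side.
    have h1 : 0 ≤ C / d * algConn G * (Fintype.card V * ∑ j, z.1 j ^ 2) := by positivity
    have h2 := mul_le_mul_of_nonneg_left hi (sq_nonneg z.2)
    linarith

end UpperBound

/-! ### Infinitesimal rigid motions -/

section RigidMotions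

variable {E : Type*} [NormedAddCommGroup E] [NormedSpace ℝ E]

/-- If `φ` attains its maximum over a sphere at `x - y`, then it vanishes on the relative velocity
`η x - η y` of every infinitesimal rigid motion `η`. -/
theorem IsInfinitesimalRigidMotion.apply_sub_eq_zero {η : E → E}
    (hη : IsInfinitesimalRigidMotion η) {x y : E} (φ : E →L[ℝ] ℝ)
    (hφ : ∀ z, ‖z‖ = ‖x - y‖ → φ z ≤ φ (x - y)) : φ (η x - η y) = 0 := by
  obtain ⟨α, hα, h⟩ := hη
  have hd : HasDerivAt (fun t => φ (α x t - α y t)) (φ (η x - η y)) 0 := by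
    rw [h x, h y]
    exact φ.hasFDerivAt.comp_hasDerivAt 0
      ((hα.differentiableAt x).hasDerivAt.sub (hα.differentiableAt y).hasDerivAt)
  refine IsLocalMax.hasDerivAt_eq_zero ?_ hd
  filter_upwards [Ioo_mem_nhds (show (-1 : ℝ) < 0 by norm_num) (show (0 : ℝ) < 1 by norm_num)]
    with t ht
  rw [hα.apply_zero, hα.apply_zero]
  exact hφ _ (hα.dist_eq t ht x y)

theorem rigidMotionDim_le_finrank [FiniteDimensional ℝ E]
    (h : ∀ η : E → E, IsInfinitesimalRigidMotion η → ∀ x y, η x = η y) :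
    rigidMotionDim E ≤ Module.finrank ℝ E := by
  let c : E →ₗ[ℝ] E → E := LinearMap.pi fun _ => LinearMap.id
  have hle : infinitesimalRigidMotions E ≤ LinearMap.range c := by
    refine Submodule.span_le.2 fun η hη => ⟨η 0, funext fun x => ?_⟩
    exact h η hη 0 x
  exact (Submodule.finrank_mono hle).trans (LinearMap.finrank_range_le c)

end RigidMotions

/-! ### Smooth points and existence of frameworks -/

section SmoothPoints

variable {E : Type*} [NormedAddCommGroup E] [NormedSpace ℝ E]

/-- A support functional exists by Hahn–Banach. For any such `φ`, `φ (u + t b_i) - ‖u + t b_i‖` is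
at most 0 and vanishes at `t = 0`, so `φ (b_i)` is forced to be the directional derivative of the
norm. -/
theorem isSmoothPoint_of_differentiableAt {ι : Type*} (b : Module.Basis ι ℝ E) {u : E} (hu : u ≠ 0)
    (h : ∀ i, DifferentiableAt ℝ (fun t : ℝ => ‖u + t • b i‖) 0) :
    IsSmoothPoint (‖u‖⁻¹ • u) := by
  have hn : ‖u‖ ≠ 0 := norm_ne_zero_iff.2 hu
  have huniq : ∀ φ : E →L[ℝ] ℝ, IsSupportFunctional (‖u‖⁻¹ • u) φ →
      ∀ i, φ (b i) = deriv (fun t : ℝ => ‖u + t • b i‖) 0 := by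
    intro φ hφ i
    have hφu : φ u = ‖u‖ := by
      have h1 := hφ.1
      rw [map_smul, smul_eq_mul] at h1
      field_simp at h1
      exact h1
    have h1 : HasDerivAt (fun t : ℝ => φ (u + t • b i)) (φ (b i)) 0 := by
      have h2 : HasDerivAt (fun t : ℝ => φ u + t * φ (b i)) (1 * φ (b i)) 0 :=
        ((hasDerivAt_id (0 : ℝ)).mul_const _).const_add _
      simpa using h2
    have h2 := h1.sub (h i).hasDerivAt
    refine sub_eq_zero.1 (IsLocalMax.hasDerivAt_eq_zero (Filter.Eventually.of_forall fun t => ?_) h2)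
    have h3 := (le_abs_self _).trans (φ.le_opNorm (u + t • b i))
    rw [hφ.2, one_mul] at h3
    simpa [hφu] using h3
  refine ⟨by simp [norm_smul, hn], ?_⟩
  obtain ⟨φ, hφ1, hφ2⟩ := exists_dual_vector ℝ u hn
  have hφ : IsSupportFunctional (‖u‖⁻¹ • u) φ := ⟨by simp [hφ2, hn], hφ1⟩
  refine ⟨φ, hφ, fun ψ hψ => ?_⟩
  have : (ψ : E →ₗ[ℝ] ℝ) = φ := b.ext fun i => (huniq ψ hψ i).trans (huniq φ hφ i).symm
  exact ContinuousLinearMap.coe_injective this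

/-- Placing the vertices on a line in a smooth direction gives a framework. -/
theorem exists_isFramework {V : Type*} [Fintype V] (G : SimpleGraph V) {u : E} (hu : u ≠ 0)
    (hs : IsSmoothPoint (‖u‖⁻¹ • u)) : ∃ p : V → E, IsFramework G p := by
  let e := Fintype.equivFin V
  refine ⟨fun v => ((e v : ℕ) : ℝ) • u, fun v w hvw => ?_⟩
  have hne : ((e v : ℕ) : ℝ) - ((e w : ℕ) : ℝ) ≠ 0 := by
    rw [sub_ne_zero]
    intro h
    exact hvw.ne (e.injective (Fin.ext (by exact_mod_cast h)))
  refine ⟨fun h => ?_, ?_⟩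
  · rw [← sub_eq_zero, ← sub_smul] at h
    exact (smul_ne_zero hne hu) h
  · rw [direction, ← sub_smul, norm_smul, smul_smul, mul_inv, Real.norm_eq_abs]
    rcases lt_or_gt_of_ne hne with h | h
    · rw [abs_of_neg h]
      convert hs.neg using 1
      rw [← neg_smul]
      congr 1
      field_simp
    · rw [abs_of_pos h]
      convert hs using 2
      field_simp

end SmoothPoints

/-! ### The signed power function -/

section PowerFunction

/-- The derivative `sgn(r) |r|^(s - 1)` of `|r|^s / s`, for `s ≥ 1`. -/
noncomputable def signedPow (s r : ℝ) : ℝ := Real.sign r * |r| ^ (s - 1)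

theorem signedPow_mul_self {s : ℝ} (hs : 1 ≤ s) (r : ℝ) : signedPow s r * r = |r| ^ s := by
  rcases eq_or_ne r 0 with rfl | hr
  · simp [signedPow, Real.zero_rpow (by linarith : s ≠ 0)]
  · have h : Real.sign r * r = |r| := by
      rcases lt_or_gt_of_ne hr with h | h
      · rw [Real.sign_of_neg h, abs_of_neg h]; ring
      · rw [Real.sign_of_pos h, abs_of_pos h]; ring
    rw [signedPow, mul_right_comm, h, Real.rpow_sub_one (abs_ne_zero.2 hr)]
    field_simp [abs_ne_zero.2 hr]

/-- Young's inequality, with equality at `t = r`. Summed over coordinates, it shows that the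
functional with coefficients `signedPow s (u j)` is maximal at `u` on the sphere through `u`. -/
theorem signedPow_mul_le {s : ℝ} (hs : 1 ≤ s) (r t : ℝ) :
    signedPow s r * t ≤ (s - 1) / s * |r| ^ s + 1 / s * |t| ^ s := by
  have hs0 : 0 < s := by linarith
  have h := Real.geom_mean_le_arith_mean2_weighted (w₁ := (s - 1) / s) (w₂ := 1 / s)
    (p₁ := |r| ^ s) (p₂ := |t| ^ s) (div_nonneg (by linarith) hs0.le) (by positivity)
    (by positivity) (by positivity) (by field_simp; ring)
  rw [← Real.rpow_mul (abs_nonneg _), ← Real.rpow_mul (abs_nonneg _),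
    mul_div_cancel₀ _ hs0.ne', mul_div_cancel₀ _ hs0.ne', Real.rpow_one] at h
  refine le_trans ((le_abs_self _).trans ?_) h
  rw [signedPow, abs_mul, abs_mul, abs_of_nonneg (Real.rpow_nonneg (abs_nonneg r) _)]
  have h1 : |Real.sign r| ≤ 1 := by
    rcases Real.sign_apply_eq r with h | h | h <;> simp [h]
  have h2 : 0 ≤ |r| ^ (s - 1) * |t| := by positivity
  rw [mul_assoc]
  exact mul_le_of_le_one_left h2 h1

theorem signedPow_zero (s : ℝ) : signedPow s 0 = 0 := by simp [signedPow]

theorem signedPow_one (s : ℝ) : signedPow s 1 = 1 := by simp [signedPow]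

theorem signedPow_ne_zero {s r : ℝ} (hr : r ≠ 0) : signedPow s r ≠ 0 := by
  have h : (0 : ℝ) < |r| ^ (s - 1) := Real.rpow_pos_of_pos (abs_pos.2 hr) _
  refine mul_ne_zero ?_ h.ne'
  rwa [Ne, Real.sign_eq_zero_iff]

/-- Homogeneity of degree `s - 1` gives the factor `2 ^ (s - 1)`, which is 2 only for `s = 2`. This
is where the Euclidean case, with its rotations, is excluded. -/
theorem signedPow_two_mul_ne {s : ℝ} (hs : s ≠ 2) {r : ℝ} (hr : r ≠ 0) :
    signedPow s (2 * r) ≠ 2 * signedPow s r := by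
  have h1 : signedPow s (2 * r) = 2 ^ (s - 1) * signedPow s r := by
    have h2 : Real.sign (2 * r) = Real.sign r := by
      rcases lt_or_gt_of_ne hr with h | h
      · rw [Real.sign_of_neg h, Real.sign_of_neg (by linarith)]
      · rw [Real.sign_of_pos h, Real.sign_of_pos (by linarith)]
    rw [signedPow, signedPow, h2, abs_mul, Real.mul_rpow (abs_nonneg _) (abs_nonneg _), abs_two]
    ring
  rw [h1]
  intro h
  have h3 : (2 : ℝ) ^ (s - 1) = 2 ^ (1 : ℝ) := by
    rw [Real.rpow_one]
    exact mul_right_cancel₀ (signedPow_ne_zero hr) h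
  have h4 := (Real.strictMono_rpow_of_base_gt_one (one_lt_two (α := ℝ))).injective h3
  exact hs (by linarith)

end PowerFunction

/-! ### The spaces `ℓ_q^d`: rigid motions, frameworks and dual norm bounds -/

section LqSpaces

variable {d : ℕ} {q : ℝ≥0∞} [Fact (1 ≤ q)]

theorem one_le_toReal (hq : q ≠ ∞) : 1 ≤ q.toReal := by
  have h := ENNReal.toReal_mono hq (Fact.out : 1 ≤ q)
  simpa using h

theorem Lq_norm_rpow (hq : q ≠ ∞) (u : Lq q d) : ‖u‖ ^ q.toReal = ∑ j, |u j| ^ q.toReal := by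
  have h := one_le_toReal hq
  have h0 : 0 ≤ ∑ j, |u j| ^ q.toReal := Finset.sum_nonneg fun j _ => by positivity
  rw [PiLp.norm_eq_sum (by linarith)]
  simp only [Real.norm_eq_abs]
  rw [← Real.rpow_mul h0, one_div_mul_cancel (by linarith), Real.rpow_one]

theorem Lq_top_norm_le {u : Lq ∞ d} {r : ℝ} (hr : 0 ≤ r) (h : ∀ i, |u i| ≤ r) : ‖u‖ ≤ r := by
  rw [PiLp.norm_eq_ciSup]
  exact Real.iSup_le h hr

theorem stdBasis_apply (i j : Fin d) : stdBasis q d i j = if j = i then 1 else 0 := by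
  rw [PiLp.basisFun_apply, PiLp.single_apply]

/-- The relative velocities of an infinitesimal rigid motion of `ℓ_q^d`, `q < ∞`. -/
theorem IsInfinitesimalRigidMotion.sum_signedPow_mul_eq_zero (hq : q ≠ ∞) {η : Lq q d → Lq q d}
    (hη : IsInfinitesimalRigidMotion η) (x y : Lq q d) :
    ∑ j, signedPow q.toReal (x j - y j) * (η x j - η y j) = 0 := by
  have hs := one_le_toReal hq
  have hs0 : 0 < q.toReal := by linarith
  let φ : Lq q d →L[ℝ] ℝ :=
    ∑ j, signedPow q.toReal (x j - y j) • PiLp.proj q (fun _ : Fin d => ℝ) j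
  have hφ : ∀ z, φ z = ∑ j, signedPow q.toReal (x j - y j) * z j := fun z => by
    simp [φ]
  have h := hη.apply_sub_eq_zero (x := x) (y := y) φ fun z hz => by
    rw [hφ, hφ]
    have h1 : ∑ j, |z j| ^ q.toReal = ∑ j, |x j - y j| ^ q.toReal := by
      rw [← Lq_norm_rpow hq, hz, Lq_norm_rpow hq]
      rfl
    have h2 : ∑ j, signedPow q.toReal (x j - y j) * (x - y) j = ∑ j, |x j - y j| ^ q.toReal :=
      Finset.sum_congr rfl fun j _ => signedPow_mul_self hs _
    rw [h2]
    refine (Finset.sum_le_sum fun j _ => signedPow_mul_le hs _ _).trans_eq ?_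
    rw [Finset.sum_add_distrib, ← Finset.mul_sum, ← Finset.mul_sum, h1]
    field_simp
    ring
  rw [hφ] at h
  exact h

/-- A function on `ℓ_q^d` that is invariant under translations along all axes is constant. -/
theorem eq_of_forall_add_smul_stdBasis {η : Lq q d → ℝ}
    (h : ∀ (x : Lq q d) (j : Fin d) (s : ℝ), η (x + s • stdBasis q d j) = η x) (x y : Lq q d) :
    η x = η y := by
  have key : ∀ (S : Finset (Fin d)) (c : Fin d → ℝ) (x : Lq q d),
      η (x + ∑ j ∈ S, c j • stdBasis q d j) = η x := by
    intro S c
    induction S using Finset.induction_on with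
    | empty => simp
    | insert j S hj ih =>
      intro x
      rw [Finset.sum_insert hj, ← add_assoc, ih, h]
  have h1 := key Finset.univ ((stdBasis q d).repr (x - y)) y
  rw [(stdBasis q d).sum_repr, add_sub_cancel] at h1
  exact h1

/-- It suffices that each component `η_i` is invariant along each axis `j`. For `j = i` the norming
relation has a single term; for `j ≠ i` it is applied in a plane parallel to the axes `i` and `j`.
-/
theorem IsInfinitesimalRigidMotion.eq_of_ne_top (hq : q ≠ ∞) (hq2 : q.toReal ≠ 2)
    {η : Lq q d → Lq q d} (hη : IsInfinitesimalRigidMotion η) (x y : Lq q d) : η x = η y := by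
  have hrel := hη.sum_signedPow_mul_eq_zero hq
  set ψ := signedPow q.toReal with hψ
  have hψ0 : ψ 0 = 0 := signedPow_zero _
  have hψ1 : ψ 1 = 1 := signedPow_one _
  ext i
  refine eq_of_forall_add_smul_stdBasis (η := fun x => η x i) (fun x j s => ?_) x y
  rcases eq_or_ne s 0 with rfl | hs
  · simp
  rcases eq_or_ne i j with rfl | hij
  · have h := hrel (x + s • stdBasis q d i) x
    rw [Finset.sum_eq_single i] at h
    · have hne : ψ ((x + s • stdBasis q d i) i - x i) ≠ 0 := by
        refine signedPow_ne_zero ?_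
        simpa [stdBasis_apply] using hs
      exact sub_eq_zero.1 ((mul_eq_zero.1 h).resolve_left hne)
    · intro k _ hk
      have : (x + s • stdBasis q d i) k - x k = 0 := by simp [hk]
      rw [this, hψ0, zero_mul]
    · simp
  · let P : ℝ → ℝ → Lq q d := fun a c => x + (a • stdBasis q d i + c • stdBasis q d j)
    have hP : ∀ a c a' c', ψ (a - a') * (η (P a c) i - η (P a' c') i) +
        ψ (c - c') * (η (P a c) j - η (P a' c') j) = 0 := by
      intro a c a' c'
      have h := hrel (P a c) (P a' c')
      rw [← Finset.sum_subset (Finset.subset_univ ({i, j} : Finset (Fin d))),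
        Finset.sum_pair hij] at h
      · have h1 : P a c i - P a' c' i = a - a' := by simp [P, hij]
        have h2 : P a c j - P a' c' j = c - c' := by simp [P, hij.symm]
        rwa [h1, h2] at h
      · intro k _ hk
        simp only [Finset.mem_insert, Finset.mem_singleton, not_or] at hk
        have h1 : P a c k - P a' c' k = 0 := by simp [P, hk.1, hk.2]
        rw [h1, hψ0, zero_mul]
    have hA : ∀ c, η (P 1 c) i = η (P 0 c) i := fun c => by
      have := hP 1 c 0 c
      simp only [sub_self, sub_zero, hψ0, hψ1] at this
      linarith
    have hB : ∀ a c, c ≠ 0 → η (P a c) j = η (P a 0) j := fun a c hc => by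
      have := hP a c a 0
      simp only [sub_self, sub_zero, hψ0, zero_mul, zero_add] at this
      exact sub_eq_zero.1 ((mul_eq_zero.1 this).resolve_left (signedPow_ne_zero hc))
    -- By `hA` and `hB`, the increments of `η_i` over `[0, s]`, `[s, 2s]` and `[0, 2s]` are `-ψ(s)
    -- D`, `-ψ(s) D` and `-ψ(2s) D`, with `D = η_j(P 1 0) - η_j(P 0 0)`. Additivity forces `(ψ(2s) -
    -- 2ψ(s)) D = 0`, hence `D = 0`.
    have e1 := hP 1 s 0 0
    have e2 := hP 1 (2 * s) 0 s
    have e3 := hP 1 (2 * s) 0 0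
    have h2s : 2 * s ≠ 0 := mul_ne_zero two_ne_zero hs
    rw [show 2 * s - s = s by ring] at e2
    simp only [sub_zero, hψ1, hA, hB _ _ hs, hB _ _ h2s, one_mul] at e1 e2 e3
    have hH : (ψ (2 * s) - 2 * ψ s) * (η (P 1 0) j - η (P 0 0) j) = 0 := by linarith
    have hH0 := (mul_eq_zero.1 hH).resolve_left (sub_ne_zero.2 (signedPow_two_mul_ne hq2 hs))
    rw [hH0, mul_zero, add_zero] at e1
    have h1 : P 0 s = x + s • stdBasis q d j := by simp only [P, zero_smul, zero_add]
    have h2 : P 0 0 = x := by simp only [P, zero_smul, add_zero]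
    rw [← h1, sub_eq_zero.1 e1, h2]

theorem IsInfinitesimalRigidMotion.eq_of_top {η : Lq ∞ d → Lq ∞ d}
    (hη : IsInfinitesimalRigidMotion η) (x y : Lq ∞ d) : η x = η y := by
  ext i
  -- If coordinate `i` realises the norm of `w - z`, the `i`-th coordinate functional is norming
  -- there.
  have key : ∀ w z : Lq ∞ d, (∀ j, |w j - z j| ≤ w i - z i) → η w i = η z i := by
    intro w z h
    have h0 : 0 ≤ w i - z i := (abs_nonneg _).trans (h i)
    refine sub_eq_zero.1 (hη.apply_sub_eq_zero (x := w) (y := z)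
      (PiLp.proj ∞ (fun _ : Fin d => ℝ) i) fun v hv => ?_)
    have h1 : ‖w - z‖ ≤ w i - z i := Lq_top_norm_le h0 h
    have h2 : v i ≤ ‖v‖ := (le_abs_self _).trans (PiLp.norm_apply_le v i)
    exact h2.trans (hv.le.trans h1)
  have hxy : ∀ j, |x j - y j| ≤ ‖x - y‖ := fun j => PiLp.norm_apply_le (x - y) j
  have hn := norm_nonneg (x - y)
  have hw : ∀ j, (x + (2 * ‖x - y‖) • stdBasis ∞ d i) j =
      x j + if j = i then 2 * ‖x - y‖ else 0 := by
    intro j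
    rw [PiLp.add_apply, PiLp.smul_apply, stdBasis_apply]
    simp
  -- Moving `x` by `2‖x - y‖` along axis `i` gives a point whose differences from both `x` and `y`
  -- are dominated by coordinate `i`.
  rw [← key (x + (2 * ‖x - y‖) • stdBasis ∞ d i) x fun j => ?_,
    key (x + (2 * ‖x - y‖) • stdBasis ∞ d i) y fun j => ?_]
  · rw [hw, hw, if_pos rfl]
    have := hxy i
    have h2 := (abs_le.1 this).1
    split_ifs with hj
    · rw [hj, abs_of_nonneg (by linarith)]
    · rw [add_zero]
      linarith [hxy j]
  · rw [hw, hw, if_pos rfl]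
    split_ifs with hj
    · rw [hj, abs_of_nonneg (by linarith)]
    · rw [add_zero, sub_self, abs_zero]
      linarith

/-- For `q ≠ 2`, the infinitesimal rigid motions of `ℓ_q^d` are translations. -/
theorem rigidMotionDim_Lq_le (hq2 : q ≠ 2) : rigidMotionDim (Lq q d) ≤ d := by
  have h := rigidMotionDim_le_finrank (E := Lq q d) fun η hη => ?_
  · rwa [Module.finrank_eq_card_basis (stdBasis q d), Fintype.card_fin] at h
  · rcases eq_or_ne q ∞ with rfl | hq
    · exact hη.eq_of_top
    · refine hη.eq_of_ne_top hq fun h => hq2 ?_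
      rw [← ENNReal.ofReal_toReal hq, h]
      simp

/-- For `q = ∞` a basis vector is a smooth direction, its maximal coordinate being unique. For `q <
∞` the all-ones vector is used: no coordinate vanishes, so the absolute values are differentiable
there even for `q = 1`. -/
theorem exists_isFramework_Lq (hd : 1 ≤ d) {V : Type*} [Fintype V] (G : SimpleGraph V) :
    ∃ p : V → Lq q d, IsFramework G p := by
  let i₀ : Fin d := ⟨0, hd⟩
  rcases eq_or_ne q ∞ with rfl | hq
  · have hu : stdBasis ∞ d i₀ ≠ 0 := (stdBasis ∞ d).ne_zero i₀
    refine exists_isFramework G hu (isSmoothPoint_of_differentiableAt (stdBasis ∞ d) hu fun i => ?_)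
    have hc : ∀ (t : ℝ) j, (stdBasis ∞ d i₀ + t • stdBasis ∞ d i) j =
        (if j = i₀ then 1 else 0) + if j = i then t else 0 := by
      intro t j
      rw [PiLp.add_apply, PiLp.smul_apply, stdBasis_apply, stdBasis_apply]
      simp
    have heq : (fun t : ℝ => ‖stdBasis ∞ d i₀ + t • stdBasis ∞ d i‖) =ᶠ[nhds 0]
        fun t => if i = i₀ then 1 + t else 1 := by
      filter_upwards [Ioo_mem_nhds (show (-1 : ℝ) < 0 by norm_num) (show (0 : ℝ) < 1 by norm_num)]
        with t ht
      have hlow := (le_abs_self _).trans (PiLp.norm_apply_le (stdBasis ∞ d i₀ + t • stdBasis ∞ d i) i₀)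
      rw [hc, if_pos rfl] at hlow
      have ht' : |t| ≤ 1 := abs_le.2 ⟨ht.1.le, ht.2.le⟩
      split_ifs with hi
      · subst hi
        rw [if_pos rfl] at hlow
        refine le_antisymm (Lq_top_norm_le (by linarith [ht.1]) fun j => ?_) hlow
        rw [hc]
        split_ifs
        · rw [abs_of_nonneg (by linarith [ht.1])]
        · simp; linarith [ht.1]
      · rw [if_neg (Ne.symm hi), add_zero] at hlow
        refine le_antisymm (Lq_top_norm_le zero_le_one fun j => ?_) hlow
        rw [hc]
        split_ifs with h1 h2 h2
        · exact absurd (h2.symm.trans h1) hi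
        · simp
        · simpa using ht'
        · simp
    refine DifferentiableAt.congr_of_eventuallyEq ?_ heq
    split_ifs <;> fun_prop
  · have hs := one_le_toReal hq
    let u : Lq q d := WithLp.toLp q fun _ => 1
    have hu : u ≠ 0 := fun h => one_ne_zero (α := ℝ) (congrArg (fun z : Lq q d => z i₀) h)
    refine exists_isFramework G hu (isSmoothPoint_of_differentiableAt (stdBasis q d) hu fun i => ?_)
    have heq : (fun t : ℝ => ‖u + t • stdBasis q d i‖) = fun t : ℝ =>
        (∑ j, |1 + t * if j = i then 1 else 0| ^ q.toReal) ^ (1 / q.toReal) := by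
      funext t
      rw [PiLp.norm_eq_sum (by linarith)]
      simp only [PiLp.add_apply, PiLp.smul_apply, stdBasis_apply, Real.norm_eq_abs, smul_eq_mul, u]
    rw [heq]
    refine DifferentiableAt.rpow_const (DifferentiableAt.fun_sum fun j _ => ?_) (Or.inl ?_)
    · refine DifferentiableAt.rpow_const (DifferentiableAt.abs (by fun_prop) (by simp))
        (Or.inl (by simp))
    · have : (d : ℝ) ≠ 0 := by exact_mod_cast (by omega : d ≠ 0)
      simpa using this

/-- Bounding the Euclidean norm of a functional on `ℓ_q^d` from a bound of the `ℓ_q` norm by a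
multiple of the Euclidean norm. -/
theorem sum_sq_apply_stdBasis_le {C : ℝ} (hC0 : 0 ≤ C)
    (hC : ∀ z : Lq q d, ‖z‖ ^ 2 ≤ C * ∑ i, z i ^ 2) (φ : Lq q d →L[ℝ] ℝ) (hφ : ‖φ‖ ≤ 1) :
    ∑ i, φ (stdBasis q d i) ^ 2 ≤ C := by
  set S := ∑ i, φ (stdBasis q d i) ^ 2 with hS
  have hS0 : 0 ≤ S := Finset.sum_nonneg fun _ _ => sq_nonneg _
  -- Testing `φ` on its own coefficient vector gives `S = φ z ≤ ‖z‖`, hence `S² ≤ C S`.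
  let z : Lq q d := WithLp.toLp q fun i => φ (stdBasis q d i)
  have hz : φ z = S := by
    have h : z = ∑ i, φ (stdBasis q d i) • stdBasis q d i := by
      conv_lhs => rw [← (stdBasis q d).sum_repr z]
      simp [z]
    rw [h, map_sum, hS]
    refine Finset.sum_congr rfl fun i _ => ?_
    rw [map_smul, smul_eq_mul, sq]
  have h1 : S ≤ ‖z‖ := by
    rw [← hz]
    refine (le_abs_self _).trans ((φ.le_opNorm z).trans ?_)
    exact mul_le_of_le_one_left (norm_nonneg z) hφ
  have h2 : S * S ≤ C * S := by
    rw [← sq]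
    exact (pow_le_pow_left₀ hS0 h1 2).trans (hC z)
  rcases hS0.eq_or_lt with h | h
  · rw [← h]; exact hC0
  · exact le_of_mul_le_mul_right h2 h

theorem Lq_norm_sq_le_of_two_lt (hq : 2 < q) (z : Lq q d) : ‖z‖ ^ 2 ≤ 1 * ∑ i, z i ^ 2 := by
  rw [one_mul]
  set S := ∑ i, z i ^ 2 with hS
  have hS0 : 0 ≤ S := Finset.sum_nonneg fun _ _ => sq_nonneg _
  have hi : ∀ i, |z i| ≤ √S := fun i => by
    refine Real.abs_le_sqrt ?_
    exact Finset.single_le_sum (f := fun i => z i ^ 2) (fun _ _ => sq_nonneg _) (Finset.mem_univ i)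
  suffices h : ‖z‖ ≤ √S by
    calc ‖z‖ ^ 2 ≤ √S ^ 2 := pow_le_pow_left₀ (norm_nonneg _) h 2
      _ = S := Real.sq_sqrt hS0
  rcases eq_or_ne q ∞ with rfl | hqt
  · exact Lq_top_norm_le (Real.sqrt_nonneg _) hi
  · have h2 : 2 < q.toReal := by
      have := (ENNReal.toReal_lt_toReal (by simp) hqt).2 hq
      simpa using this
    -- Two factors of `|z i|` are kept for the sum of squares; the remaining `q - 2` are bounded by
    -- `√S`.
    have hsplit : ∀ r : ℝ, 0 ≤ r → r ^ q.toReal = r ^ (q.toReal - 2) * r ^ 2 := fun r hr => by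
      rw [← Real.rpow_natCast r 2, ← Real.rpow_add_of_nonneg hr (by linarith) (by norm_num)]
      norm_num
    refine (Real.rpow_le_rpow_iff (norm_nonneg _) (Real.sqrt_nonneg _)
      (by linarith : 0 < q.toReal)).1 ?_
    rw [Lq_norm_rpow hqt, hsplit _ (Real.sqrt_nonneg S), Real.sq_sqrt hS0, hS, Finset.mul_sum]
    refine Finset.sum_le_sum fun i _ => ?_
    rw [hsplit _ (abs_nonneg _), sq_abs]
    exact mul_le_mul_of_nonneg_right
      (Real.rpow_le_rpow (abs_nonneg _) (hi i) (by linarith)) (sq_nonneg _)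

/-- The power mean inequality with exponent `2 / q ≥ 1`, applied to the numbers `|z i| ^ q`. -/
theorem Lq_norm_sq_le_of_lt_two (hq : q < 2) (z : Lq q d) :
    ‖z‖ ^ 2 ≤ (d : ℝ) ^ (2 / q.toReal - 1) * ∑ i, z i ^ 2 := by
  have hqt : q ≠ ∞ := (hq.trans (by simp)).ne
  have hs := one_le_toReal hqt
  have h2 : q.toReal < 2 := by
    have := (ENNReal.toReal_lt_toReal hqt (by simp)).2 hq
    simpa using this
  have h := Real.rpow_sum_le_const_mul_sum_rpow_of_nonneg (Finset.univ : Finset (Fin d))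
    (f := fun i => |z i| ^ q.toReal) (p := 2 / q.toReal)
    (by rw [le_div_iff₀ (by linarith)]; linarith) (fun i _ => by positivity)
  have hm : ∀ r : ℝ, 0 ≤ r → (r ^ q.toReal) ^ (2 / q.toReal) = r ^ 2 := fun r hr => by
    rw [← Real.rpow_mul hr, mul_div_cancel₀ _ (by linarith), ← Real.rpow_natCast r 2]
    norm_num
  rw [← Lq_norm_rpow hqt, hm _ (norm_nonneg _), Finset.card_univ, Fintype.card_fin] at h
  simpa only [hm _ (abs_nonneg _), sq_abs] using h

/-- A uniform bound of the rigidity eigenvalues makes the algebraic connectivity in `ℓ_q^d` a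
genuine supremum with the same bound. -/
theorem isLUB_algConnIn_Lq (hd : 1 ≤ d) {V : Type*} [Fintype V] [DecidableEq V]
    (G : SimpleGraph V) [DecidableRel G.Adj] {B : ℝ}
    (hB : ∀ p : V → Lq q d, IsFramework G p → rigidityEigenvalue G (stdBasis q d) p ≤ B) :
    IsLUB (rigidityEigenvalues G (stdBasis q d)) (algConnIn G (stdBasis q d)) ∧
      algConnIn G (stdBasis q d) ≤ B := by
  obtain ⟨p, hp⟩ := exists_isFramework_Lq (q := q) hd G
  have hne : (rigidityEigenvalues G (stdBasis q d)).Nonempty := ⟨_, p, hp, rfl⟩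
  have hub : B ∈ upperBounds (rigidityEigenvalues G (stdBasis q d)) := by
    rintro _ ⟨p, hp, rfl⟩
    exact hB p hp
  exact ⟨isLUB_csSup hne ⟨B, hub⟩, csSup_le hne hub⟩

end LqSpaces

end NormedRigidity

/-- For `d ≥ 2`, `1 ≤ q ≤ ∞` and a finite simple graph `G` with at least `d + 1` vertices, the
supremum defining `a(G, ℓ_q^d)` is a genuine one for `q ≠ 2`, and `a(G, ℓ_q^d)` is at most
`a(G) / d ^ (2 - 2 / q)` if `q < 2` and at most `a(G) / d` if `q > 2`. -/
theorem corollaryc (d : ℕ) (hd : 2 ≤ d) (q : ℝ≥0∞) [Fact (1 ≤ q)]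
    {V : Type*} [Fintype V] [DecidableEq V] (G : SimpleGraph V) [DecidableRel G.Adj]
    (hV : d + 1 ≤ Fintype.card V) :
    (q < 2 →
      IsLUB (NormedRigidity.rigidityEigenvalues G (NormedRigidity.stdBasis q d))
        (NormedRigidity.algConnIn G (NormedRigidity.stdBasis q d)) ∧
      NormedRigidity.algConnIn G (NormedRigidity.stdBasis q d) ≤
        1 / (d : ℝ) ^ (2 - 2 / q.toReal) * NormedRigidity.algConn G) ∧
    (2 < q →
      IsLUB (NormedRigidity.rigidityEigenvalues G (NormedRigidity.stdBasis q d))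
        (NormedRigidity.algConnIn G (NormedRigidity.stdBasis q d)) ∧
      NormedRigidity.algConnIn G (NormedRigidity.stdBasis q d) ≤
        1 / (d : ℝ) * NormedRigidity.algConn G) := by
  have hd0 : (0 : ℝ) < d := by exact_mod_cast (by omega : 0 < d)
  refine ⟨fun hq => ?_, fun hq => ?_⟩
  · have hC : 1 / (d : ℝ) ^ (2 - 2 / q.toReal) = (d : ℝ) ^ (2 / q.toReal - 1) / d := by
      rw [← Real.rpow_sub_one hd0.ne', one_div, ← Real.rpow_neg hd0.le]
      congr 1
      ring
    rw [hC]
    refine NormedRigidity.isLUB_algConnIn_Lq (by omega) G fun p hp => ?_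
    exact NormedRigidity.rigidityEigenvalue_le G _ (by omega) hV
      (NormedRigidity.rigidMotionDim_Lq_le hq.ne)
      (NormedRigidity.sum_sq_apply_stdBasis_le (by positivity)
        (NormedRigidity.Lq_norm_sq_le_of_lt_two hq)) hp
  · refine NormedRigidity.isLUB_algConnIn_Lq (by omega) G fun p hp => ?_
    exact NormedRigidity.rigidityEigenvalue_le G _ (by omega) hV
      (NormedRigidity.rigidMotionDim_Lq_le hq.ne')
      (NormedRigidity.sum_sq_apply_stdBasis_le zero_le_one
        (NormedRigidity.Lq_norm_sq_le_of_two_lt hq)) hp
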